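/- Let $M\ge 0$, let $\beta,\delta,k$ be nonzero complex constants, and treat $\alpha$ as a formal parameter. For $n\in\mathbb Z$ let $a_n$ (row vectors) and $b_n$ (column vectors) have $M$ components, and let $u_n,w_n$ be scalars; all of them are formal power series in $\alpha$ whose coefficients are complex-valued functions of time, time derivatives being taken coefficientwise. The leading coefficient of $u_n$ is assumed nonzero, and $u_n^\delta=\exp(\delta\log u_n)$ for a branch of $\log u_n$ that is continuous in time. Consider the first flow $$\begin{aligned} & a_{n,t_1}-\alpha a_{n-1}-\beta u_{n+1}^\delta a_{n+1}-w_na_n=0,\\ & b_{n,t_1}+\beta u_n^\delta b_{n-1}+\alpha b_{n+1}+b_nw_n=0,\\ & u_{n,t_1}+u_n(a_{n-1}b_{n-1}-a_nb_n)=0,\\ & w_{n,t_1}+\alpha\delta(a_{n-1}b_n-a_nb_{n+1})=0, \end{aligned}$$ the second flow $$\begin{aligned} & a_{n,t_2}-\beta\delta u_{n+1}^\delta a_{n+1}=0,\\ & b_{n,t_2}+\beta\delta u_n^\delta b_{n-1}=0,\\ & u_{n,t_2}+u_n(w_{n-1}-w_n)+\delta u_n(a_{n-1}b_{n-1}-a_nb_n)=0,\\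 & w_{n,t_2}+\alpha\beta\delta(u_n^\delta-u_{n+1}^\delta)=0, \end{aligned}$$ and the linear combinations $\partial_T=\mu\partial_{t_1}+\nu\partial_{t_2}$, where $\mu,\nu$ are arbitrary constants (possibly formal power series in $\alpha$). There exist power series in $\alpha$ of the form $$\begin{aligned} \beta u_n^\delta &= k+\delta a_{n-1}b_n+\alpha\frac{\delta}{k}a_{n-2}\Bigl(I+\frac{\delta}{k}b_na_{n-1}\Bigr)b_{n+1}+\alpha^2u_n^{(2)}+\alpha^3u_n^{(3)}+\cdots,\\ w_n &= \alpha\frac{\delta}{k}a_{n-1}b_{n+1}+\alpha^2\frac{\delta}{k^2}a_{n-2}\Bigl(I+\frac{\delta}{k}b_na_{n-1}\Bigr)\Bigl(I+\frac{\delta}{k}b_{n+1}a_n\Bigr)b_{n+2}+\alpha^3w_n^{(3)}+\alpha^4w_n^{(4)}+\cdots \end{aligned}$$ ($I$ the $M\times M$ identity matrix), whose coefficients $u_n^{(j)},w_n^{(j)}$ are local functions, namely polynomials in finitely many components of the vectors $a_{n+i},b_{n+i}$ $(i\in\mathbb Z)$, with complex coefficients that depend only on $M,\delta,k,j$ and not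 on $n$, $\beta$, $\mu$, $\nu$, such that the first flow, the second flow and every linear combination $\partial_T$ of them admit the reduction defined by these two series. That is, for each of these flows: if $\beta u_n^\delta$ and $w_n$ are given by these series for times near $t_0$, for every $n$, and the equations of motion of all $a_n$ and $b_n$ hold at $t_0$, then the equations of motion of all $u_n$ and $w_n$ hold at $t_0$. -/

import Mathlib

open scoped PowerSeries Matrix Topology

noncomputable section

namespace GenToda

/-- The exponential of a formal power series `θ = θ₀ + O(α)` over `ℂ` in the formal
parameter `α`: `exp θ = e^{θ₀} · ∑ₘ (θ - θ₀)ᵐ / m!`. -/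
def formalExp (θ : ℂ⟦X⟧) : ℂ⟦X⟧ :=
  PowerSeries.C (Complex.exp (PowerSeries.constantCoeff θ)) *
    (PowerSeries.exp ℂ).subst (θ - PowerSeries.C (PowerSeries.constantCoeff θ))

/-- The parameter `α`, treated as a formal variable. -/
abbrev alpha : ℂ⟦X⟧ := PowerSeries.X

/-- Values of all lattice variables at one instant of time, as formal power series in `α`.
The vectors `aₙ` (row) and `bₙ` (column) have `M` components. The scalar `uₙ`, of which
powers with an arbitrary complex exponent are taken, is given through a logarithm. -/
structure LatticeState (M : ℕ) where
  a : ℤ → Fin M → ℂ⟦X⟧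
  b : ℤ → Fin M → ℂ⟦X⟧
  logU : ℤ → ℂ⟦X⟧
  w : ℤ → ℂ⟦X⟧

/-- `uₙ = exp (log uₙ)`. -/
def LatticeState.u {M : ℕ} (s : LatticeState M) (n : ℤ) : ℂ⟦X⟧ :=
  formalExp (s.logU n)

/-- `uₙ ^ δ = exp (δ log uₙ)`. -/
def LatticeState.uPow {M : ℕ} (s : LatticeState M) (δ : ℂ) (n : ℤ) : ℂ⟦X⟧ :=
  formalExp (PowerSeries.C δ * s.logU n)

/-- Time derivatives of all lattice variables. -/
structure LatticeVelocity (M : ℕ) where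
  a : ℤ → Fin M → ℂ⟦X⟧
  b : ℤ → Fin M → ℂ⟦X⟧
  u : ℤ → ℂ⟦X⟧
  w : ℤ → ℂ⟦X⟧

/-- An evolutionary lattice system: the time derivatives as functions of the state. -/
abbrev Flow (M : ℕ) := LatticeState M → LatticeVelocity M

/-- The first flow for `γ = 0`, solved for the time derivatives. -/
def firstFlow {M : ℕ} (β δ : ℂ) : Flow M := fun s =>
  { a := fun n => alpha • s.a (n - 1)
      + (PowerSeries.C β * s.uPow δ (n + 1)) • s.a (n + 1) + s.w n • s.a n
    b := fun n => -((PowerSeries.C β * s.uPow δ n) • s.b (n - 1)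
      + alpha • s.b (n + 1) + s.w n • s.b n)
    u := fun n => -(s.u n * (s.a (n - 1) ⬝ᵥ s.b (n - 1) - s.a n ⬝ᵥ s.b n))
    w := fun n => -(alpha * PowerSeries.C δ *
      (s.a (n - 1) ⬝ᵥ s.b n - s.a n ⬝ᵥ s.b (n + 1))) }

/-- The second flow for `γ = 0`, solved for the time derivatives. -/
def secondFlow {M : ℕ} (β δ : ℂ) : Flow M := fun s =>
  { a := fun n => (PowerSeries.C (β * δ) * s.uPow δ (n + 1)) • s.a (n + 1)
    b := fun n => -((PowerSeries.C (β * δ) * s.uPow δ n) • s.b (n - 1))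
    u := fun n => -(s.u n * (s.w (n - 1) - s.w n)
      + PowerSeries.C δ * s.u n * (s.a (n - 1) ⬝ᵥ s.b (n - 1) - s.a n ⬝ᵥ s.b n))
    w := fun n => -(alpha * PowerSeries.C (β * δ) * (s.uPow δ n - s.uPow δ (n + 1))) }

/-- The flow `∂_T = μ ∂_{t₁} + ν ∂_{t₂}`; the constants may depend on `α`. -/
def linComb {M : ℕ} (μ ν : ℂ⟦X⟧) (F G : Flow M) : Flow M := fun s =>
  { a := fun n => μ • (F s).a n + ν • (G s).a n
    b := fun n => μ • (F s).b n + ν • (G s).b n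
    u := fun n => μ * (F s).u n + ν * (G s).u n
    w := fun n => μ * (F s).w n + ν * (G s).w n }

/-- Coefficientwise time derivative of a curve of formal power series in `α`. -/
def HasTimeDerivAt (f : ℝ → ℂ⟦X⟧) (f' : ℂ⟦X⟧) (t₀ : ℝ) : Prop :=
  ∀ j : ℕ, HasDerivAt (fun t => PowerSeries.coeff j (f t)) (PowerSeries.coeff j f') t₀

/-- Local functions: polynomials in (finitely many of) the components of the vectors
`a_{n+i}` (`Sum.inl (i, c)`) and `b_{n+i}` (`Sum.inr (i, c)`), with `i` the site relative
to `n` and `c` the component. -/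
abbrev LocalPoly (M : ℕ) := MvPolynomial ((ℤ × Fin M) ⊕ (ℤ × Fin M)) ℂ

/-- The vector `a_{n+i}` of local functions. -/
def aVar (M : ℕ) (i : ℤ) : Fin M → LocalPoly M := fun c => MvPolynomial.X (Sum.inl (i, c))

/-- The vector `b_{n+i}` of local functions. -/
def bVar (M : ℕ) (i : ℤ) : Fin M → LocalPoly M := fun c => MvPolynomial.X (Sum.inr (i, c))

/-- The matrix `I + (δ / k) b_{n+i} a_{n+j}`. -/
def dressing (M : ℕ) (δ k : ℂ) (i j : ℤ) : Matrix (Fin M) (Fin M) (LocalPoly M) :=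
  1 + (MvPolynomial.C (δ / k) : LocalPoly M) • Matrix.vecMulVec (bVar M i) (aVar M j)

/-- The value of a local function at the site `n`. -/
def evalAt {M : ℕ} (f : LocalPoly M) (s : LatticeState M) (n : ℤ) : ℂ⟦X⟧ :=
  MvPolynomial.aeval
    (Sum.elim (fun p => s.a (n + p.1) p.2) (fun p => s.b (n + p.1) p.2)) f

/-- The value at the site `n` of the power series `∑ⱼ αʲ fⱼ` with local coefficients `fⱼ`
(the sum is finite for each coefficient of the result). -/
def evalSeries {M : ℕ} (f : ℕ → LocalPoly M) (s : LatticeState M) (n : ℤ) : ℂ⟦X⟧ :=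
  PowerSeries.mk fun m =>
    ∑ j ∈ Finset.range (m + 1), PowerSeries.coeff (m - j) (evalAt (f j) s n)

/-- The flow `F` admits the reduction `β uₙ^δ = ∑ⱼ αʲ Uⱼ`, `wₙ = ∑ⱼ αʲ Wⱼ`: whenever
`uₙ` and `wₙ` are given by these series near the time `t₀` (with a continuous branch of the
logarithm of `uₙ`) and `aₙ`, `bₙ` satisfy their equations of motion at `t₀`,
then `uₙ` and `wₙ` satisfy theirs at `t₀`. -/
def AdmitsReduction {M : ℕ} (β δ : ℂ) (U W : ℕ → LocalPoly M) (F : Flow M) : Prop :=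
  ∀ (s : ℝ → LatticeState M) (t₀ : ℝ),
    (∀ n, ContinuousAt (fun t => PowerSeries.constantCoeff ((s t).logU n)) t₀) →
    (∀ n, ∀ᶠ t in 𝓝 t₀, PowerSeries.C β * (s t).uPow δ n = evalSeries U (s t) n) →
    (∀ n, ∀ᶠ t in 𝓝 t₀, (s t).w n = evalSeries W (s t) n) →
    (∀ n c, HasTimeDerivAt (fun t => (s t).a n c) ((F (s t₀)).a n c) t₀) →
    (∀ n c, HasTimeDerivAt (fun t => (s t).b n c) ((F (s t₀)).b n c) t₀) →
    ∀ n, HasTimeDerivAt (fun t => (s t).u n) ((F (s t₀)).u n) t₀ ∧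
      HasTimeDerivAt (fun t => (s t).w n) ((F (s t₀)).w n) t₀

end GenToda

end

/-! Let `S` be the shift on sequences indexed by `ℤ` and `A` the matrix with entries `aₙ bₘ`. Along
the flow with parameters `μ, ν`, once `w` and `P = β u^δ` are substituted, `A` moves by the
commutator with `B = p P S + q (α S⁻¹ + w)`, where `p = μ + δ ν` and `q = μ`; `P S` has the entry
`Pₙ₊₁` at `(n, n + 1)`.

The reduction comes from `F = k G S`, with `G` unipotent upper triangular and `H = G⁻¹`, by
requiring `F + α k F⁻¹ = P S + w + α S⁻¹ - δ A₊`, where `A₊` is the strictly upper part of `A`. Off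
the first superdiagonal this determines `G` and `H` recursively as series in `α` with coefficients
polynomial in the products `aₙ bₘ` (`dressCoeff`); the diagonal and the first superdiagonal define
`w` and `P`.

The commutators of `B` with `F` and `F⁻¹` give candidate velocities `dG`, `dH`. They satisfy the
time derivative of the equations defining `G` and `H` (`dG_mul_H_add`, `dG_upper`). The true
velocities exist, the coefficients being polynomials, and satisfy the same linear system, whose
solution is unique `α`-adically (`velocity_unique`). Hence `H` moves by `dH` (`hasTimeDerivAt_H`),
and its entries next to the diagonal give the equations for `w` and `P` (`alpha_mul_dH_w`, `dP`).
Passing from `u^δ` to `u` is a matter of logarithmic derivatives of formal exponentials. -/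

namespace GenToda

/-! ### Coefficientwise time derivatives -/

namespace HasTimeDerivAt

variable {f g : ℝ → ℂ⟦X⟧} {f' g' : ℂ⟦X⟧} {t₀ : ℝ}

theorem const (c : ℂ⟦X⟧) (t₀ : ℝ) : HasTimeDerivAt (fun _ => c) 0 t₀ := fun j => by
  simpa using hasDerivAt_const t₀ (PowerSeries.coeff j c)

theorem add (hf : HasTimeDerivAt f f' t₀) (hg : HasTimeDerivAt g g' t₀) :
    HasTimeDerivAt (fun t => f t + g t) (f' + g') t₀ := fun j => by
  simpa using (hf j).fun_add (hg j)

theorem neg (hf : HasTimeDerivAt f f' t₀) : HasTimeDerivAt (fun t => -f t) (-f') t₀ := fun j => by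
  simpa using (hf j).fun_neg

theorem mul (hf : HasTimeDerivAt f f' t₀) (hg : HasTimeDerivAt g g' t₀) :
    HasTimeDerivAt (fun t => f t * g t) (f' * g t₀ + f t₀ * g') t₀ := fun j => by
  simp only [PowerSeries.coeff_mul, map_add, ← Finset.sum_add_distrib]
  exact HasDerivAt.fun_sum fun i _ => (hf i.1).mul (hg i.2)

theorem const_mul (c : ℂ⟦X⟧) (hf : HasTimeDerivAt f f' t₀) :
    HasTimeDerivAt (fun t => c * f t) (c * f') t₀ := by
  simpa using (const c t₀).mul hf

theorem sum {ι : Type*} (s : Finset ι) {f : ι → ℝ → ℂ⟦X⟧} {f' : ι → ℂ⟦X⟧}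
    (h : ∀ i ∈ s, HasTimeDerivAt (f i) (f' i) t₀) :
    HasTimeDerivAt (fun t => ∑ i ∈ s, f i t) (∑ i ∈ s, f' i) t₀ := fun j => by
  simpa using HasDerivAt.fun_sum fun i hi => h i hi j

theorem unique (hf : HasTimeDerivAt f f' t₀) (hg : HasTimeDerivAt f g' t₀) : f' = g' :=
  PowerSeries.ext fun j => (hf j).unique (hg j)

theorem congr (hf : HasTimeDerivAt f f' t₀) (h : ∀ᶠ t in 𝓝 t₀, g t = f t) :
    HasTimeDerivAt g f' t₀ := fun j =>
  (hf j).congr_of_eventuallyEq (h.mono fun t ht => by simp [ht])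

theorem congr_deriv (hf : HasTimeDerivAt f f' t₀) (h : f' = g') : HasTimeDerivAt f g' t₀ :=
  h ▸ hf

/-- The time derivative commutes with the formal derivative in `α`. -/
theorem derivative (hf : HasTimeDerivAt f f' t₀) :
    HasTimeDerivAt (fun t => d⁄dX ℂ (f t)) (d⁄dX ℂ f') t₀ := fun j => by
  simpa [PowerSeries.coeff_derivative] using (hf (j + 1)).mul_const ((j : ℂ) + 1)

end HasTimeDerivAt

theorem exists_hasTimeDerivAt {f : ℝ → ℂ⟦X⟧} {t₀ : ℝ}
    (h : ∀ j, DifferentiableAt ℝ (fun t => PowerSeries.coeff j (f t)) t₀) :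
    ∃ f', HasTimeDerivAt f f' t₀ :=
  ⟨PowerSeries.mk fun j => deriv (fun t => PowerSeries.coeff j (f t)) t₀, fun j => by
    simpa using (h j).hasDerivAt⟩

/-- A factor of a differentiable product is differentiable if the other factor is differentiable
and has a nonzero leading coefficient. -/
theorem exists_hasTimeDerivAt_of_mul {f g h : ℝ → ℂ⟦X⟧} {f' h' : ℂ⟦X⟧} {t₀ : ℝ}
    (hf : HasTimeDerivAt f f' t₀) (hh : HasTimeDerivAt h h' t₀) (hfg : ∀ t, f t * g t = h t)
    (h0 : ∀ t, PowerSeries.constantCoeff (f t) ≠ 0) : ∃ g', HasTimeDerivAt g g' t₀ := by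
  refine exists_hasTimeDerivAt fun j => ?_
  induction j using Nat.strong_induction_on with
  | _ j ih =>
    -- The pair `(0, j)` of the Cauchy product isolates `coeff j` of `g`; all other pairs involve
    -- lower coefficients of `g`.
    have key : ∀ t, PowerSeries.coeff j (g t) = (PowerSeries.coeff j (h t) -
        ∑ i ∈ (Finset.HasAntidiagonal.antidiagonal j).erase (0, j),
          PowerSeries.coeff i.1 (f t) * PowerSeries.coeff i.2 (g t)) /
        PowerSeries.coeff 0 (f t) := by
      intro t
      have h1 : PowerSeries.coeff 0 (f t) ≠ 0 := by simpa using h0 t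
      rw [eq_div_iff h1, ← hfg, PowerSeries.coeff_mul,
        ← Finset.add_sum_erase _ _ (show (0, j) ∈ Finset.HasAntidiagonal.antidiagonal j by simp)]
      ring
    simp_rw [key]
    refine DifferentiableAt.div ((hh j).differentiableAt.sub (DifferentiableAt.fun_sum ?_))
      (hf 0).differentiableAt (by simpa using h0 t₀)
    rintro ⟨i, l⟩ hi
    simp only [Finset.mem_erase, ne_eq, Prod.mk.injEq, Finset.HasAntidiagonal.mem_antidiagonal] at hi
    exact (hf i).differentiableAt.mul (ih l (by omega))

/-! ### The exponential of a formal power series -/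

theorem hasSubst_sub_C (θ : ℂ⟦X⟧) :
    PowerSeries.HasSubst (θ - PowerSeries.C (PowerSeries.constantCoeff θ)) :=
  PowerSeries.HasSubst.of_constantCoeff_zero' (by simp)

theorem constantCoeff_formalExp (θ : ℂ⟦X⟧) :
    PowerSeries.constantCoeff (formalExp θ) = Complex.exp (PowerSeries.constantCoeff θ) := by
  have h : PowerSeries.exp ℂ = PowerSeries.C 1 + (PowerSeries.exp ℂ - PowerSeries.C 1) := by ring
  have h2 : PowerSeries.constantCoeff ((PowerSeries.exp ℂ).subst
      (θ - PowerSeries.C (PowerSeries.constantCoeff θ))) = 1 := by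
    rw [h, PowerSeries.subst_add (hasSubst_sub_C θ), map_add]
    have h3 : PowerSeries.constantCoeff ((PowerSeries.exp ℂ - PowerSeries.C 1).subst
        (θ - PowerSeries.C (PowerSeries.constantCoeff θ))) = 0 :=
      PowerSeries.constantCoeff_subst_eq_zero (by
        exact (by simp : PowerSeries.constantCoeff
          (θ - PowerSeries.C (PowerSeries.constantCoeff θ)) = 0)) _ (by simp)
    rw [h3, map_one, ← PowerSeries.coe_substAlgHom (hasSubst_sub_C θ), map_one]
    simp
  simp [formalExp, h2]

theorem derivative_formalExp (θ : ℂ⟦X⟧) :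
    d⁄dX ℂ (formalExp θ) = formalExp θ * d⁄dX ℂ θ := by
  unfold formalExp
  rw [Derivation.leibniz, PowerSeries.derivative_subst (hasSubst_sub_C θ),
    PowerSeries.derivative_exp]
  simp
  ring

/-- Coefficient `j` of the equation for `y - z` expresses `(j + 1)` times coefficient `j + 1`
through lower ones, so all coefficients vanish with the first. -/
theorem ode_unique {θ y z : ℂ⟦X⟧} {r : ℂ⟦X⟧} (hy : d⁄dX ℂ y = y * θ + r)
    (hz : d⁄dX ℂ z = z * θ + r)
    (h0 : PowerSeries.constantCoeff y = PowerSeries.constantCoeff z) : y = z := by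
  have hd : d⁄dX ℂ (y - z) = (y - z) * θ := by rw [map_sub, hy, hz]; ring
  have h : ∀ j, PowerSeries.coeff j (y - z) = 0 := by
    intro j
    induction j using Nat.strong_induction_on with
    | _ j ih =>
      cases j with
      | zero => simpa [sub_eq_zero] using h0
      | succ j =>
        have h1 := congrArg (PowerSeries.coeff j) hd
        rw [PowerSeries.coeff_derivative, PowerSeries.coeff_mul, Finset.sum_eq_zero] at h1
        · exact (mul_eq_zero.mp h1).resolve_right (by exact_mod_cast j.succ_ne_zero)
        · intro i hi
          rw [Finset.HasAntidiagonal.mem_antidiagonal] at hi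
          rw [ih i.1 (by omega), zero_mul]
  exact sub_eq_zero.mp (PowerSeries.ext fun j => by simpa using h j)

/-- Chain rule for the formal exponential. -/
theorem HasTimeDerivAt.formalExp {θ : ℝ → ℂ⟦X⟧} {θ' : ℂ⟦X⟧} {t₀ : ℝ}
    (h : HasTimeDerivAt θ θ' t₀) :
    HasTimeDerivAt (fun t => formalExp (θ t)) (GenToda.formalExp (θ t₀) * θ') t₀ := by
  have h0 : HasDerivAt (fun t => PowerSeries.coeff 0 (GenToda.formalExp (θ t)))
      (PowerSeries.coeff 0 (GenToda.formalExp (θ t₀) * θ')) t₀ := by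
    have h1 := h 0
    simp only [PowerSeries.coeff_zero_eq_constantCoeff, map_mul, constantCoeff_formalExp] at h1 ⊢
    exact h1.cexp
  have hD := h.derivative
  obtain ⟨y', hy'⟩ : ∃ y', HasTimeDerivAt (fun t => GenToda.formalExp (θ t)) y' t₀ := by
    refine exists_hasTimeDerivAt fun j => ?_
    induction j using Nat.strong_induction_on with
    | _ j ih =>
      cases j with
      | zero => exact h0.differentiableAt
      | succ j =>
        -- The equation `(exp θ)' = exp θ · θ'` in `α` makes each coefficient a polynomial in
        -- earlier ones and those of `θ'`.
        have key : ∀ t, PowerSeries.coeff (j + 1) (GenToda.formalExp (θ t)) =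
            (∑ i ∈ Finset.HasAntidiagonal.antidiagonal j, PowerSeries.coeff i.1 (GenToda.formalExp (θ t)) *
              PowerSeries.coeff i.2 (d⁄dX ℂ (θ t))) / ((j : ℂ) + 1) := by
          intro t
          rw [eq_div_iff (by exact_mod_cast j.succ_ne_zero), ← PowerSeries.coeff_derivative,
            derivative_formalExp, PowerSeries.coeff_mul]
        simp_rw [key]
        refine (DifferentiableAt.fun_sum fun i hi => ?_).div_const _
        rw [Finset.HasAntidiagonal.mem_antidiagonal] at hi
        exact (ih i.1 (by omega)).mul (hD i.2).differentiableAt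
  refine hy'.congr_deriv ?_
  -- Time and `α` derivatives commute, so `y'` and `exp θ · θ'` solve one linear equation in `α`
  -- with the same constant term.
  have h1 : d⁄dX ℂ y' = y' * d⁄dX ℂ (θ t₀) + GenToda.formalExp (θ t₀) * d⁄dX ℂ θ' := by
    refine hy'.derivative.unique ?_
    simp_rw [derivative_formalExp]
    exact hy'.mul hD
  refine ode_unique h1 ?_ (by simpa using (hy' 0).unique h0)
  rw [Derivation.leibniz, derivative_formalExp]
  simp
  ring

/-- A continuous logarithm of a differentiable function is differentiable. -/
theorem differentiableAt_of_cexp {θ : ℝ → ℂ} {t₀ : ℝ} (hc : ContinuousAt θ t₀)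
    (hd : DifferentiableAt ℝ (fun t => Complex.exp (θ t)) t₀) : DifferentiableAt ℝ θ t₀ := by
  have hslit : (1 : ℂ) ∈ Complex.slitPlane := Complex.one_mem_slitPlane
  -- Dividing by the value at `t₀` moves the argument of the principal logarithm to `1`, away from
  -- the cut; continuity of `θ` then selects the right branch.
  have h1 : DifferentiableAt ℝ
      (fun t => Complex.log (Complex.exp (θ t) / Complex.exp (θ t₀)) + θ t₀) t₀ := by
    refine DifferentiableAt.add_const _ ?_
    refine (HasDerivAt.clog_real (hd.div_const _).hasDerivAt ?_).differentiableAt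
    rw [div_self (Complex.exp_ne_zero _)]
    exact hslit
  refine h1.congr_of_eventuallyEq ?_
  have h2 : Filter.Tendsto (fun t => (θ t - θ t₀).im) (𝓝 t₀) (𝓝 0) := by
    have : ContinuousAt (fun t => (θ t - θ t₀).im) t₀ :=
      Complex.continuous_im.continuousAt.comp (hc.sub continuousAt_const)
    simpa [ContinuousAt] using this
  filter_upwards [h2.eventually (Ioo_mem_nhds (neg_lt_zero.mpr Real.pi_pos) Real.pi_pos)]
    with t ht
  rw [← Complex.exp_sub, Complex.log_exp ht.1 ht.2.le]
  ring

/-- If a power `exp (δ θ)` has logarithmic time derivative `δ g`, then `exp θ` has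
logarithmic time derivative `g`. -/
theorem hasTimeDerivAt_formalExp_of_pow {δ : ℂ} (hδ : δ ≠ 0) {θ : ℝ → ℂ⟦X⟧} {g : ℂ⟦X⟧} {t₀ : ℝ}
    (hc : ContinuousAt (fun t => PowerSeries.constantCoeff (θ t)) t₀)
    (h : HasTimeDerivAt (fun t => formalExp (PowerSeries.C δ * θ t))
      (formalExp (PowerSeries.C δ * θ t₀) * (PowerSeries.C δ * g)) t₀) :
    HasTimeDerivAt (fun t => formalExp (θ t)) (formalExp (θ t₀) * g) t₀ := by
  have hne : ∀ t, PowerSeries.constantCoeff (formalExp (PowerSeries.C δ * θ t)) ≠ 0 := fun t => by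
    rw [constantCoeff_formalExp]; exact Complex.exp_ne_zero _
  have hCδ : PowerSeries.C δ ≠ (0 : ℂ⟦X⟧) := by simpa using hδ
  -- The `α`-derivative of `δ θ` is a quotient of differentiable series. This controls every
  -- coefficient of `θ` except the constant one, which needs the continuous branch.
  obtain ⟨η, hη⟩ := exists_hasTimeDerivAt_of_mul h h.derivative
    (fun t => (derivative_formalExp _).symm) hne
  obtain ⟨θ', hθ'⟩ : ∃ θ', HasTimeDerivAt θ θ' t₀ := by
    refine exists_hasTimeDerivAt fun j => ?_
    cases j with
    | zero =>
      have h0 := (h 0).differentiableAt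
      simp only [PowerSeries.coeff_zero_eq_constantCoeff, constantCoeff_formalExp] at h0 ⊢
      have h1 := differentiableAt_of_cexp (θ := fun t =>
        PowerSeries.constantCoeff (PowerSeries.C δ * θ t)) (by
          simpa using continuousAt_const.fun_mul hc) h0
      refine (h1.const_mul δ⁻¹).congr_of_eventuallyEq (Filter.Eventually.of_forall fun t => ?_)
      simp [inv_mul_cancel_left₀ hδ]
    | succ j =>
      have h1 := (hη j).differentiableAt
      refine (h1.const_mul (δ⁻¹ * ((j : ℂ) + 1)⁻¹)).congr_of_eventuallyEq
        (Filter.Eventually.of_forall fun t => ?_)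
      have hj : (j : ℂ) + 1 ≠ 0 := by exact_mod_cast j.succ_ne_zero
      simp only [PowerSeries.coeff_derivative, PowerSeries.coeff_C_mul]
      field_simp
  have hu := (hθ'.const_mul (PowerSeries.C δ)).formalExp.unique h
  have hne' : formalExp (PowerSeries.C δ * θ t₀) ≠ 0 := fun h0 => hne t₀ (by simp [h0])
  have : θ' = g := mul_left_cancel₀ hCδ (mul_left_cancel₀ hne' hu)
  exact this ▸ hθ'.formalExp

/-! ### Dressing of a constant-coefficient operator

The reduction says that the Lax operator of the hierarchy is `F + α k F⁻¹` with `F = k G S`, where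
`S` is the shift and `G = H⁻¹` is a unipotent upper triangular matrix indexed by `ℤ`. The flow
acts on such a matrix by the commutator with `p P S + q (α S⁻¹ + w)`. -/

/-- Data of the reduced Lax operator: `A n m` stands for the product `aₙ bₘ`, `P n` for `β uₙ^δ`,
and `G`, `H` are mutually inverse unipotent upper triangular matrices. -/
structure ReducedLax (K : Type*) [CommRing K] (α δ k : K) where
  A : ℤ → ℤ → K
  G : ℤ → ℤ → K
  H : ℤ → ℤ → K
  G_diag : ∀ n, G n n = 1
  G_lower : ∀ n m, m < n → G n m = 0
  H_diag : ∀ n, H n n = 1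
  H_lower : ∀ n m, m < n → H n m = 0
  G_upper : ∀ n m, n < m → k * G n m = -(δ * A n (m + 1) + α * H (n - 1) (m + 1))
  G_mul_H : ∀ n m lo hi, lo ≤ n → m ≤ hi →
    ∑ x ∈ Finset.Icc lo hi, G n x * H x m = if n = m then 1 else 0

theorem sum_Icc_telescope {K : Type*} [AddCommGroup K] (T : ℤ → K) (lo : ℤ) (d : ℕ) :
    ∑ x ∈ Finset.Icc lo (lo + d), (T (x + 1) - T x) = T (lo + d + 1) - T lo := by
  induction d with
  | zero => simp
  | succ d ih =>
    have : Finset.Icc lo (lo + (d + 1 : ℕ)) = insert (lo + d + 1) (Finset.Icc lo (lo + d)) := by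
      ext x; simp; omega
    rw [this, Finset.sum_insert (by simp), ih]
    push_cast
    rw [← add_assoc]
    abel

namespace ReducedLax

variable {K : Type*} [CommRing K] {α δ k : K} (D : ReducedLax K α δ k) (p q : K)

/-- The diagonal of `F + α k F⁻¹`. -/
def w (n : ℤ) : K := α * D.H (n - 1) n

/-- The entry `(n - 1, n)` of `F + α k F⁻¹ + δ A`. -/
def P (n : ℤ) : K := k + δ * D.A (n - 1) n + α * D.H (n - 2) n

/-- The velocity of `aₙ bₘ`. -/
def dA (n m : ℤ) : K :=
  p * (D.P (n + 1) * D.A (n + 1) m - D.A n (m - 1) * D.P m) +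
    q * (α * D.A (n - 1) m - α * D.A n (m + 1) + (D.w n - D.w m) * D.A n m)

/-- The velocity of `G`. -/
def dG (n m : ℤ) : K :=
  p * (D.P (n + 1) * D.G (n + 1) m - D.G n (m - 1) * D.P (m + 1)) +
    q * (α * D.G (n - 1) m - α * D.G n (m + 1) + (D.w n - D.w (m + 1)) * D.G n m)

/-- The velocity of `H`. -/
def dH (n m : ℤ) : K :=
  p * (D.P (n + 2) * D.H (n + 1) m - D.H n (m - 1) * D.P m) +
    q * (α * D.H (n - 1) m - α * D.H n (m + 1) + (D.w (n + 1) - D.w m) * D.H n m)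

theorem G_succ (n : ℤ) : D.G n (n + 1) = -D.H n (n + 1) := by
  have h := D.G_mul_H n (n + 1) n (n + 1) le_rfl le_rfl
  have h2 : Finset.Icc n (n + 1) = {n, n + 1} := by ext x; simp; omega
  rw [h2, Finset.sum_pair (by omega), D.G_diag, D.H_diag, if_neg (by omega)] at h
  linear_combination h

/-- The commutator must keep `G` unipotent. On the diagonal this is what the choice of `w` achieves:
`α G (n - 1) n` cancels `w n`. -/
theorem dG_lower (n m : ℤ) (h : m ≤ n) : D.dG p q n m = 0 := by
  have h1 : D.G (n + 1) m = 0 := D.G_lower _ _ (by omega)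
  have h2 : D.G n (m - 1) = 0 := D.G_lower _ _ (by omega)
  rw [dG, h1, h2]
  obtain rfl | h := h.eq_or_lt
  · have h3 := D.G_succ m
    have h4 := D.G_succ (m - 1)
    simp only [sub_add_cancel] at h4
    rw [h3, h4, D.G_diag, w, w]
    simp only [add_sub_cancel_right]
    ring
  · rw [D.G_lower n m h]
    obtain rfl | h := (show m ≤ n - 1 by omega).eq_or_lt
    · simp only [sub_add_cancel]
      rw [D.G_diag, D.G_diag]
      ring
    · rw [D.G_lower _ _ h, D.G_lower n (m + 1) (by omega)]
      ring

theorem dH_lower (n m : ℤ) (h : m < n) : D.dH p q n m = 0 := by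
  have h1 : D.H (n + 1) m = 0 := D.H_lower _ _ (by omega)
  have h2 : D.H n (m - 1) = 0 := D.H_lower _ _ (by omega)
  rw [dH, h1, h2, D.H_lower n m h]
  obtain rfl | h := (show m ≤ n - 1 by omega).eq_or_lt
  · simp only [sub_add_cancel]
    rw [D.H_diag, D.H_diag]
    ring
  · rw [D.H_lower _ _ h, D.H_lower n (m + 1) (by omega)]
    ring

/-- `dG` and `dH` are compatible with `G H = 1`. -/
theorem dG_mul_H_add (n m : ℤ) (hnm : n ≤ m) :
    ∑ x ∈ Finset.Icc (n - 2) (m + 2),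
      (D.dG p q n x * D.H x m + D.G n x * D.dH p q x m) = 0 := by
  -- The terms in which `P S` or `α S⁻¹` acts between `G` and `H` cancel after a shift of the
  -- summation index; `T` records that shift, and triangularity kills it at both ends. What remains
  -- are entries of `G H = 1`.
  set T : ℤ → K := fun x => p * (D.G n (x - 1) * D.P (x + 1) * D.H x m) -
    q * (α * D.G n x * D.H (x - 1) m) with hT
  have hsum : ∀ x, D.dG p q n x * D.H x m + D.G n x * D.dH p q x m =
      (T (x + 1) - T x) - p * D.P m * (D.G n x * D.H x (m - 1))
        + p * D.P (n + 1) * (D.G (n + 1) x * D.H x m)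
        - q * α * (D.G n x * D.H x (m + 1)) + q * α * (D.G (n - 1) x * D.H x m)
        + q * (D.w n - D.w m) * (D.G n x * D.H x m) := by
    intro x
    simp only [hT, dG, dH, add_sub_cancel_right, show x + 1 + 1 = x + 2 by ring]
    ring
  have htel : ∑ x ∈ Finset.Icc (n - 2) (m + 2), (T (x + 1) - T x) = 0 := by
    obtain ⟨d, hd⟩ := Int.eq_ofNat_of_zero_le (show 0 ≤ m + 2 - (n - 2) by omega)
    rw [show m + 2 = n - 2 + d by omega, sum_Icc_telescope,
      show n - 2 + (d : ℤ) + 1 = m + 3 by omega]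
    simp only [hT]
    rw [D.H_lower (m + 3) m (by omega), D.H_lower (m + 3 - 1) m (by omega),
      D.G_lower n (n - 2) (by omega), D.G_lower n (n - 2 - 1) (by omega)]
    ring
  simp only [hsum, Finset.sum_add_distrib, Finset.sum_sub_distrib, ← Finset.mul_sum]
  rw [Finset.sum_sub_distrib] at htel
  rw [htel, D.G_mul_H n (m - 1) _ _ (by omega) (by omega),
    D.G_mul_H (n + 1) m _ _ (by omega) (by omega), D.G_mul_H n (m + 1) _ _ (by omega) (by omega),
    D.G_mul_H (n - 1) m _ _ (by omega) (by omega), D.G_mul_H n m _ _ (by omega) (by omega),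
    if_neg (show ¬ n = m + 1 by omega), if_neg (show ¬ n - 1 = m by omega)]
  by_cases h1 : n = m
  · subst h1
    rw [if_neg (by omega), if_neg (by omega)]
    ring
  · by_cases h2 : n + 1 = m
    · rw [if_neg h1, if_pos h2, if_pos (by omega), h2]
      ring
    · rw [if_neg h1, if_neg h2, if_neg (by omega)]
      ring

/-- `dG` and `dH` are compatible with the equation that determines `G`. -/
theorem dG_upper (n m : ℤ) (hnm : n < m) :
    k * D.dG p q n m = -(δ * D.dA p q n (m + 1) + α * D.dH p q (n - 1) (m + 1)) := by
  have hG1 := D.G_upper (n - 1) m (by omega)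
  have hG2 := D.G_upper n (m + 1) (by omega)
  have hG3 := D.G_upper n m hnm
  -- The defining equation is applied in a neighbouring row here and in a neighbouring column in
  -- `hP2`. It fails only on the first superdiagonal, by `P`, and the two defects cancel because `P
  -- S` commutes with itself.
  have hP1 : k * D.G (n + 1) m + δ * D.A (n + 1) (m + 1) + α * D.H n (m + 1) =
      if n + 1 = m then D.P (m + 1) else 0 := by
    split_ifs with h
    · subst h
      rw [D.G_diag, P]
      simp only [add_sub_cancel_right, show n + 1 + 1 - 2 = n by ring]
      ring
    · rw [D.G_upper (n + 1) m (by omega), add_sub_cancel_right]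
      ring
  have hP2 : k * D.G n (m - 1) + δ * D.A n m + α * D.H (n - 1) m =
      if n + 1 = m then D.P (n + 1) else 0 := by
    split_ifs with h
    · subst h
      rw [add_sub_cancel_right, D.G_diag, P]
      simp only [add_sub_cancel_right, show n + 1 - 2 = n - 1 by ring]
      ring
    · rw [D.G_upper n (m - 1) (by omega), sub_add_cancel]
      ring
  have hP3 : D.P (n + 1) * (if n + 1 = m then D.P (m + 1) else 0) =
      (if n + 1 = m then D.P (n + 1) else 0) * D.P (m + 1) := by
    split_ifs <;> ring
  simp only [dG, dA, dH, add_sub_cancel_right, sub_add_cancel,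
    show n - 1 + 2 = n + 1 by ring] at *
  linear_combination p * D.P (n + 1) * hP1 - p * D.P (m + 1) * hP2 + p * hP3 + q * α * hG1
    - q * α * hG2 + q * (D.w n - D.w (m + 1)) * hG3

/-- A velocity of `G` and `H` compatible with their defining equations is `dG`, `dH`. -/
theorem velocity_unique {κ : K} (hκ : κ * k = 1)
    (hα : ∀ x : K, (∀ N : ℕ, α ^ N ∣ x) → x = 0) {G' H' : ℤ → ℤ → K}
    (hG'_lower : ∀ n m, m ≤ n → G' n m = 0) (hH'_lower : ∀ n m, m < n → H' n m = 0)
    (hG' : ∀ n m, n < m →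
      k * G' n m = -(δ * D.dA p q n (m + 1) + α * H' (n - 1) (m + 1)))
    (hGH' : ∀ n m, ∑ x ∈ Finset.Icc (n - 2) (m + 2), (G' n x * D.H x m + D.G n x * H' x m) = 0)
    (n m : ℤ) : H' n m = D.dH p q n m := by
  suffices h : ∀ N : ℕ, ∀ n m, α ^ N ∣ H' n m - D.dH p q n m from
    sub_eq_zero.mp (hα _ fun N => h N n m)
  intro N
  induction N with
  | zero => intro n m; simp
  | succ N ih =>
    -- The error in `G` is a multiple of `α` times an error in `H`, so it gains one power of `α`.
    have hΔ : ∀ n m, α ^ (N + 1) ∣ G' n m - D.dG p q n m := by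
      intro n m
      obtain h | h := le_or_gt m n
      · rw [hG'_lower n m h, D.dG_lower p q n m h, sub_zero]
        exact dvd_zero _
      · have h1 : G' n m - D.dG p q n m =
            α * (H' (n - 1) (m + 1) - D.dH p q (n - 1) (m + 1)) * -κ := by
          linear_combination κ * hG' n m h - κ * D.dG_upper p q n m h
            - (G' n m - D.dG p q n m) * hκ
        rw [h1, pow_succ']
        exact (mul_dvd_mul_left α (ih _ _)).mul_right _
    -- The varied equation `G H = 1` is solved for the entry `(n, m)`, whose coefficient is `G n n =
    -- 1`; the other errors of `H` that survive lie in rows `x > n`, closer to the diagonal.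
    suffices h : ∀ d : ℕ, ∀ n m : ℤ, m - n < d → α ^ (N + 1) ∣ H' n m - D.dH p q n m from
      fun n m => h ((m - n).toNat + 1) n m (by omega)
    intro d
    induction d with
    | zero =>
      intro n m hd
      rw [hH'_lower n m (by omega), D.dH_lower p q n m (by omega), sub_zero]
      exact dvd_zero _
    | succ d ihd =>
      intro n m hd
      by_cases hlt : m < n
      · rw [hH'_lower n m hlt, D.dH_lower p q n m hlt, sub_zero]
        exact dvd_zero _
      have h1 : ∑ x ∈ Finset.Icc (n - 2) (m + 2), ((G' n x - D.dG p q n x) * D.H x m +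
          D.G n x * (H' x m - D.dH p q x m)) = 0 := by
        have h2 := (hGH' n m).trans (D.dG_mul_H_add p q n m (by omega)).symm
        rw [← sub_eq_zero, ← Finset.sum_sub_distrib] at h2
        rw [← h2]
        exact Finset.sum_congr rfl fun x _ => by ring
      have hmem : n ∈ Finset.Icc (n - 2) (m + 2) := by
        rw [Finset.mem_Icc]; omega
      rw [Finset.sum_add_distrib, ← Finset.add_sum_erase _
        (fun x => D.G n x * (H' x m - D.dH p q x m)) hmem] at h1
      simp only [D.G_diag, one_mul] at h1
      have h2 : H' n m - D.dH p q n m =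
          -(∑ x ∈ Finset.Icc (n - 2) (m + 2), (G' n x - D.dG p q n x) * D.H x m) -
          ∑ x ∈ (Finset.Icc (n - 2) (m + 2)).erase n, D.G n x * (H' x m - D.dH p q x m) := by
        linear_combination h1
      rw [h2]
      refine dvd_sub ((Finset.dvd_sum fun x _ => (hΔ n x).mul_right _).neg_right)
        (Finset.dvd_sum fun x hx => ?_)
      rw [Finset.mem_erase] at hx
      obtain h | h := lt_or_gt_of_ne hx.1
      · rw [D.G_lower n x h, zero_mul]
        exact dvd_zero _
      · exact (ihd x m (by omega)).mul_left _

/-- The velocity of `w`. -/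
theorem alpha_mul_dH_w (n : ℤ) : α * D.dH p q (n - 1) n =
    α * (p * (D.P (n + 1) - D.P n)) - α * q * ((D.P (n + 1) - D.P n)
      - δ * (D.A n (n + 1) - D.A (n - 1) n)) := by
  simp only [dH, sub_add_cancel, show n - 1 + 2 = n + 1 by ring, show n - 1 - 1 = n - 2 by ring,
    D.H_diag]
  have h1 : D.P n = k + δ * D.A (n - 1) n + α * D.H (n - 2) n := rfl
  have h2 : D.P (n + 1) = k + δ * D.A n (n + 1) + α * D.H (n - 1) (n + 1) := by
    rw [P, add_sub_cancel_right, show n + 1 - 2 = n - 1 by ring]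
  linear_combination α * q * h2 - α * q * h1

/-- The velocity of `P`. -/
theorem dP (n : ℤ) : δ * D.dA p q (n - 1) n + α * D.dH p q (n - 2) n =
    D.P n * ((p - q) * (D.w n - D.w (n - 1)) +
      δ * (p * (D.A n n - D.A (n - 1) (n - 1)))) := by
  -- The far entries `H (n - 3) n` and `H (n - 2) (n + 1)` enter only together with `δ A`; `G_upper`
  -- and `G_succ` turn these sums into `k H (n - 2) (n - 1)` and `k H (n - 1) n`.
  have h1 : D.P n = k + δ * D.A (n - 1) n + α * D.H (n - 2) n := rfl
  have h2 : D.w n = α * D.H (n - 1) n := rfl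
  have h3 : D.w (n - 1) = α * D.H (n - 2) (n - 1) := by
    rw [w, show n - 1 - 1 = n - 2 by ring]
  have h4 := D.G_upper (n - 2) (n - 1) (by omega)
  have h5 := D.G_succ (n - 2)
  have h6 := D.G_upper (n - 1) n (by omega)
  have h7 := D.G_succ (n - 1)
  simp only [sub_add_cancel, show n - 2 + 1 = n - 1 by ring, show n - 2 - 1 = n - 3 by ring,
    show n - 1 - 1 = n - 2 by ring] at h4 h5 h6 h7
  simp only [dA, dH, sub_add_cancel, show n - 2 + 1 = n - 1 by ring,
    show n - 2 + 2 = n by ring, show n - 2 - 1 = n - 3 by ring,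
    show n - 1 - 1 = n - 2 by ring]
  rw [h5] at h4
  rw [h7] at h6
  linear_combination (-p * D.P n) * (h2 - h3) + q * (D.w n - D.w (n - 1)) * h1 + q * α * (h4 - h6)
    + q * k * (h2 - h3)

end ReducedLax

/-! ### Summation of series in `α` whose coefficients depend on `α` -/

theorem eq_of_X_pow_dvd {x y : ℂ⟦X⟧} (h : ∀ N : ℕ, PowerSeries.X ^ N ∣ x - y) : x = y := by
  refine sub_eq_zero.mp (PowerSeries.ext fun j => ?_)
  simpa using PowerSeries.X_pow_dvd_iff.mp (h (j + 1)) j j.lt_succ_self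

/-- The sum `∑ⱼ αʲ fⱼ`. -/
noncomputable def alphaSum (f : ℕ → ℂ⟦X⟧) : ℂ⟦X⟧ :=
  PowerSeries.mk fun m => ∑ j ∈ Finset.range (m + 1), PowerSeries.coeff (m - j) (f j)

theorem alphaSum_eq (f : ℕ → ℂ⟦X⟧) :
    alphaSum f = f 0 + PowerSeries.X * alphaSum (fun j => f (j + 1)) := by
  ext m
  cases m with
  | zero => simp [alphaSum]
  | succ m =>
    rw [map_add, PowerSeries.coeff_succ_X_mul]
    simp only [alphaSum, PowerSeries.coeff_mk]
    rw [Finset.sum_range_succ', add_comm]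
    simp

theorem alphaSum_add (f g : ℕ → ℂ⟦X⟧) :
    alphaSum (fun j => f j + g j) = alphaSum f + alphaSum g := by
  ext m
  simp [alphaSum, Finset.sum_add_distrib]

theorem alphaSum_zero : alphaSum (fun _ => 0) = 0 := by
  ext m
  simp [alphaSum]

theorem alphaSum_sum {ι : Type*} (s : Finset ι) (f : ι → ℕ → ℂ⟦X⟧) :
    alphaSum (fun j => ∑ i ∈ s, f i j) = ∑ i ∈ s, alphaSum (f i) := by
  classical
  induction s using Finset.induction_on with
  | empty => simpa using alphaSum_zero
  | insert i s hi ih => simp [Finset.sum_insert hi, alphaSum_add, ih]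

/-- Since `c` itself depends on `α`, coefficients do not match term by term; peeling off one summand
shows agreement modulo every power of `α`. -/
theorem alphaSum_const_mul (c : ℂ⟦X⟧) (f : ℕ → ℂ⟦X⟧) :
    alphaSum (fun j => c * f j) = c * alphaSum f := by
  refine eq_of_X_pow_dvd fun N => ?_
  induction N generalizing f with
  | zero => simp
  | succ N ih =>
    rw [alphaSum_eq, alphaSum_eq f]
    convert mul_dvd_mul_left PowerSeries.X (ih fun j => f (j + 1)) using 1 <;> ring

theorem alphaSum_mul (f g : ℕ → ℂ⟦X⟧) :
    alphaSum (fun j => ∑ i ∈ Finset.HasAntidiagonal.antidiagonal j, f i.1 * g i.2) =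
      alphaSum f * alphaSum g := by
  refine eq_of_X_pow_dvd fun N => ?_
  induction N generalizing f with
  | zero => simp
  | succ N ih =>
    rw [alphaSum_eq]
    simp only [Finset.Nat.antidiagonal_succ, Finset.sum_cons, Finset.sum_map]
    rw [alphaSum_add, alphaSum_const_mul]
    convert mul_dvd_mul_left PowerSeries.X (ih fun j => f (j + 1)) using 1
    · ring
    · have h0 : ∑ i ∈ Finset.HasAntidiagonal.antidiagonal 0, f i.1 * g i.2 = f 0 * g 0 := by simp
      rw [alphaSum_eq f, h0]
      simp only [Function.Embedding.prodMap, Function.Embedding.coeFn_mk, Prod.map,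
        Function.Embedding.refl_apply, Nat.succ_eq_add_one]
      linear_combination -f 0 * alphaSum_eq g

/-! ### The coefficients of the reduction -/

section Coefficients

variable {A : Type*} [CommRing A]

/-- The coefficients of the expansion in `α` of the unipotent matrix `H` that satisfies
`H = 1 + e H + κ α (S⁻¹ H S) H`, the products being restricted to the strictly upper parts
of their left factors. -/
noncomputable def dressCoeff (e : ℤ → ℤ → A) (κ : A) (j : ℕ) (n m : ℤ) : A :=
  (if j = 0 ∧ n = m then 1 else 0) +
    ∑ x ∈ (Finset.Ioc n m).attach, (e n x * dressCoeff e κ j x m +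
      κ * ∑ i : Fin j, dressCoeff e κ i (n - 1) (x + 1) * dressCoeff e κ (j - 1 - i) x m)
-- The first term keeps the order `j` but shortens the interval; the second may lengthen the
-- interval but lowers the order.
termination_by (j, (m - n).toNat)
decreasing_by
  · have := x.2
    rw [Finset.mem_Ioc] at this
    exact Prod.Lex.right _ (by omega)
  · exact Prod.Lex.left _ _ i.2
  · exact Prod.Lex.left _ _ (by omega)

variable (e : ℤ → ℤ → A) (κ : A)

theorem dressCoeff_zero (n m : ℤ) : dressCoeff e κ 0 n m = (if n = m then 1 else 0) +
    ∑ x ∈ Finset.Ioc n m, e n x * dressCoeff e κ 0 x m := by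
  rw [dressCoeff, Finset.sum_attach (Finset.Ioc n m) (fun x => e n x * dressCoeff e κ 0 x m +
    κ * ∑ i : Fin 0, dressCoeff e κ i (n - 1) (x + 1) * dressCoeff e κ (0 - 1 - i) x m)]
  simp

theorem dressCoeff_succ (j : ℕ) (n m : ℤ) : dressCoeff e κ (j + 1) n m =
    ∑ x ∈ Finset.Ioc n m, (e n x * dressCoeff e κ (j + 1) x m +
      κ * ∑ i ∈ Finset.HasAntidiagonal.antidiagonal j,
        dressCoeff e κ i.1 (n - 1) (x + 1) * dressCoeff e κ i.2 x m) := by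
  rw [dressCoeff, Finset.sum_attach (Finset.Ioc n m) (fun x => e n x * dressCoeff e κ (j + 1) x m +
    κ * ∑ i : Fin (j + 1), dressCoeff e κ i (n - 1) (x + 1) *
      dressCoeff e κ (j + 1 - 1 - i) x m)]
  rw [if_neg (by omega), zero_add]
  refine Finset.sum_congr rfl fun x _ => ?_
  rw [Finset.Nat.sum_antidiagonal_eq_sum_range_succ
    (fun i l => dressCoeff e κ i (n - 1) (x + 1) * dressCoeff e κ l x m),
    Finset.sum_range fun i => dressCoeff e κ i (n - 1) (x + 1) * dressCoeff e κ (j - i) x m]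
  rfl

theorem dressCoeff_lower (j : ℕ) {n m : ℤ} (h : m < n) : dressCoeff e κ j n m = 0 := by
  cases j with
  | zero => rw [dressCoeff_zero, if_neg h.ne', Finset.Ioc_eq_empty (by omega)]; simp
  | succ j => rw [dressCoeff_succ, Finset.Ioc_eq_empty (by omega)]; simp

theorem dressCoeff_diag_zero (n : ℤ) : dressCoeff e κ 0 n n = 1 := by
  rw [dressCoeff_zero]; simp

theorem dressCoeff_diag_succ (j : ℕ) (n : ℤ) : dressCoeff e κ (j + 1) n n = 0 := by
  rw [dressCoeff_succ]; simp

/-- Naturality of the coefficients, combined with translation along the lattice. -/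
theorem map_dressCoeff {B : Type*} [CommRing B] (φ : A →+* B) (N : ℤ) (E : ℤ → ℤ → B)
    (he : ∀ x y, φ (e x y) = E (x + N) (y + N)) (j : ℕ) (n m : ℤ) :
    φ (dressCoeff e κ j n m) = dressCoeff E (φ κ) j (n + N) (m + N) := by
  have hsum : ∀ (n m : ℤ) (F : ℤ → B), ∑ x ∈ Finset.Ioc (n + N) (m + N), F x =
      ∑ x ∈ Finset.Ioc n m, F (x + N) := by
    intro n m F
    rw [← Finset.map_add_right_Ioc, Finset.sum_map]
    rfl
  induction j using Nat.strong_induction_on generalizing n m with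
  | _ j ihj =>
    suffices h : ∀ d : ℕ, ∀ n m : ℤ, m - n < d →
        φ (dressCoeff e κ j n m) = dressCoeff E (φ κ) j (n + N) (m + N) from
      h ((m - n).toNat + 1) n m (by omega)
    intro d
    induction d with
    | zero =>
      intro n m hd
      rw [dressCoeff_lower e κ j (by omega), dressCoeff_lower E _ j (by omega), map_zero]
    | succ d ihd =>
      intro n m hd
      cases j with
      | zero =>
        rw [dressCoeff_zero, dressCoeff_zero, hsum, map_add, map_sum]
        congr 1
        · simp [apply_ite φ]
        · refine Finset.sum_congr rfl fun x hx => ?_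
          rw [Finset.mem_Ioc] at hx
          rw [map_mul, he, ihd x m (by omega)]
      | succ j =>
        rw [dressCoeff_succ, dressCoeff_succ, hsum, map_sum]
        refine Finset.sum_congr rfl fun x hx => ?_
        rw [Finset.mem_Ioc] at hx
        rw [map_add, map_mul, map_mul, he, ihd x m (by omega), map_sum]
        congr 2
        refine Finset.sum_congr rfl fun i hi => ?_
        rw [Finset.HasAntidiagonal.mem_antidiagonal] at hi
        rw [map_mul, ihj i.1 (by omega), ihj i.2 (by omega), sub_add_eq_add_sub,
          add_right_comm x 1 N]

end Coefficients

/-- The sum of the series with coefficients `dressCoeff`. -/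
noncomputable def dressSum (e : ℤ → ℤ → ℂ⟦X⟧) (κ : ℂ⟦X⟧) (n m : ℤ) : ℂ⟦X⟧ :=
  alphaSum fun j => dressCoeff e κ j n m

theorem dressSum_eq (e : ℤ → ℤ → ℂ⟦X⟧) (κ : ℂ⟦X⟧) (n m : ℤ) :
    dressSum e κ n m = (if n = m then 1 else 0) + ∑ x ∈ Finset.Ioc n m,
      (e n x + κ * (alpha * dressSum e κ (n - 1) (x + 1))) * dressSum e κ x m := by
  rw [dressSum, alphaSum_eq, dressCoeff_zero]
  rw [funext fun j => dressCoeff_succ e κ j n m, alphaSum_sum]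
  rw [Finset.mul_sum, add_assoc, ← Finset.sum_add_distrib]
  congr 1
  refine Finset.sum_congr rfl fun x _ => ?_
  have h1 : dressSum e κ x m = dressCoeff e κ 0 x m +
      PowerSeries.X * alphaSum fun j => dressCoeff e κ (j + 1) x m :=
    alphaSum_eq fun j => dressCoeff e κ j x m
  have h2 : (alphaSum fun j => ∑ i ∈ Finset.HasAntidiagonal.antidiagonal j,
      dressCoeff e κ i.1 (n - 1) (x + 1) * dressCoeff e κ i.2 x m) =
      dressSum e κ (n - 1) (x + 1) * dressSum e κ x m :=
    alphaSum_mul (fun j => dressCoeff e κ j (n - 1) (x + 1)) (fun j => dressCoeff e κ j x m)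
  rw [alphaSum_add, alphaSum_const_mul, alphaSum_const_mul, h2]
  linear_combination (-e n x) * h1

theorem dressSum_lower (e : ℤ → ℤ → ℂ⟦X⟧) (κ : ℂ⟦X⟧) {n m : ℤ} (h : m < n) :
    dressSum e κ n m = 0 := by
  rw [dressSum_eq, if_neg h.ne', Finset.Ioc_eq_empty (by omega)]; simp

theorem dressSum_diag (e : ℤ → ℤ → ℂ⟦X⟧) (κ : ℂ⟦X⟧) (n : ℤ) : dressSum e κ n n = 1 := by
  rw [dressSum_eq]; simp

/-- The reduced Lax operator built from the products `aₙ bₘ`. -/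
noncomputable def reducedLax (δ k : ℂ) (hk : k ≠ 0) (A : ℤ → ℤ → ℂ⟦X⟧) :
    ReducedLax ℂ⟦X⟧ alpha (PowerSeries.C δ) (PowerSeries.C k) :=
  let e : ℤ → ℤ → ℂ⟦X⟧ := fun n m => PowerSeries.C (δ / k) * A n (m + 1)
  let H := dressSum e (PowerSeries.C k⁻¹)
  { A := A
    H := H
    G := fun n m => if n = m then 1 else
      if n < m then -(e n m + PowerSeries.C k⁻¹ * (alpha * H (n - 1) (m + 1))) else 0
    G_diag := fun n => if_pos rfl
    G_lower := fun n m h => by simp [h.ne', h.le]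
    H_diag := dressSum_diag _ _
    H_lower := fun n m h => dressSum_lower _ _ h
    G_upper := fun n m h => by
      have h1 : PowerSeries.C k * PowerSeries.C (δ / k) = (PowerSeries.C δ : ℂ⟦X⟧) := by
        rw [← map_mul, mul_div_cancel₀ _ hk]
      have h2 : PowerSeries.C k * PowerSeries.C k⁻¹ = (1 : ℂ⟦X⟧) := by
        rw [← map_mul, mul_inv_cancel₀ hk, map_one]
      simp only [if_neg h.ne, if_pos h, e]
      linear_combination -A n (m + 1) * h1 - alpha * H (n - 1) (m + 1) * h2
    G_mul_H := fun n m lo hi hlo hhi => by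
      by_cases hnm : m < n
      · rw [if_neg hnm.ne']
        refine Finset.sum_eq_zero fun x _ => ?_
        obtain hx | hx := lt_or_ge x n
        · simp [hx.ne', hx.le]
        · simp only [H]
          rw [dressSum_lower _ _ (hnm.trans_le hx), mul_zero]
      · have hsub : insert n (Finset.Ioc n m) ⊆ Finset.Icc lo hi := by
          intro x; simp; omega
        rw [← Finset.sum_subset hsub, Finset.sum_insert (by simp)]
        · simp only [if_true, one_mul, H]
          rw [dressSum_eq, add_assoc, ← Finset.sum_add_distrib, Finset.sum_eq_zero, add_zero]
          intro x hx
          rw [Finset.mem_Ioc] at hx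
          rw [if_neg hx.1.ne, if_pos hx.1]
          ring
        · intro x _ hx
          simp only [Finset.mem_insert, Finset.mem_Ioc, not_or, not_and, not_le] at hx
          obtain hx' | hx' := lt_or_ge x n
          · simp [hx'.ne', hx'.le]
          · simp only [H]
            rw [dressSum_lower _ _ (hx.2 (lt_of_le_of_ne hx' (Ne.symm hx.1))), mul_zero] }

/-! ### The reduction -/

/-- The local function `(δ / k) a_{n+i} b_{n+j+1}`. -/
noncomputable def dressEntry (M : ℕ) (δ k : ℂ) (i j : ℤ) : LocalPoly M :=
  MvPolynomial.C (δ / k) * (aVar M i ⬝ᵥ bVar M (j + 1))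

/-- The coefficients of `β uₙ^δ`. -/
noncomputable def reductionU (M : ℕ) (δ k : ℂ) : ℕ → LocalPoly M
  | 0 => MvPolynomial.C k + MvPolynomial.C δ * (aVar M (-1) ⬝ᵥ bVar M 0)
  | j + 1 => dressCoeff (dressEntry M δ k) (MvPolynomial.C k⁻¹) j (-2) 0

/-- The coefficients of `wₙ`. -/
noncomputable def reductionW (M : ℕ) (δ k : ℂ) : ℕ → LocalPoly M
  | 0 => 0
  | j + 1 => dressCoeff (dressEntry M δ k) (MvPolynomial.C k⁻¹) j (-1) 0

/-! ### Explicit coefficients of low order -/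

section Explicit

variable {A : Type*} [CommRing A] (e : ℤ → ℤ → A) (κ : A) (n : ℤ)

theorem dressCoeff_zero_one : dressCoeff e κ 0 n (n + 1) = e n (n + 1) := by
  have h : Finset.Ioc n (n + 1) = {n + 1} := by ext x; simp; omega
  rw [dressCoeff_zero, h, Finset.sum_singleton, dressCoeff_diag_zero, if_neg (by omega)]
  ring

theorem dressCoeff_zero_two : dressCoeff e κ 0 n (n + 2) =
    e n (n + 2) + e n (n + 1) * e (n + 1) (n + 2) := by
  have h : Finset.Ioc n (n + 2) = {n + 1, n + 2} := by ext x; simp; omega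
  have h1 := dressCoeff_zero_one e κ (n + 1)
  rw [add_assoc, one_add_one_eq_two] at h1
  rw [dressCoeff_zero, h, Finset.sum_pair (by omega), dressCoeff_diag_zero, if_neg (by omega), h1]
  ring

theorem dressCoeff_zero_three : dressCoeff e κ 0 n (n + 3) =
    e n (n + 3) + e n (n + 1) * e (n + 1) (n + 3) + e n (n + 2) * e (n + 2) (n + 3) +
      e n (n + 1) * e (n + 1) (n + 2) * e (n + 2) (n + 3) := by
  have h : Finset.Ioc n (n + 3) = {n + 1, n + 2, n + 3} := by ext x; simp; omega
  have h1 := dressCoeff_zero_two e κ (n + 1)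
  have h2 := dressCoeff_zero_one e κ (n + 2)
  rw [show n + 1 + 2 = n + 3 by ring, show n + 1 + 1 = n + 2 by ring] at h1
  rw [show n + 2 + 1 = n + 3 by ring] at h2
  rw [dressCoeff_zero, h, Finset.sum_insert (by simp), Finset.sum_pair (by omega),
    dressCoeff_diag_zero, if_neg (by omega), h1, h2]
  ring

theorem dressCoeff_one_one : dressCoeff e κ 1 n (n + 1) =
    κ * dressCoeff e κ 0 (n - 1) (n + 2) := by
  have h : Finset.Ioc n (n + 1) = {n + 1} := by ext x; simp; omega
  rw [dressCoeff_succ, h, Finset.sum_singleton, dressCoeff_diag_succ]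
  simp [dressCoeff_diag_zero, show n + 1 + 1 = n + 2 by ring]

end Explicit

theorem dressing_mulVec (M : ℕ) (δ k : ℂ) (i j l : ℤ) :
    dressing M δ k i j *ᵥ bVar M l =
      bVar M l + (MvPolynomial.C (δ / k) * (aVar M j ⬝ᵥ bVar M l)) • bVar M i := by
  rw [dressing, Matrix.add_mulVec, Matrix.one_mulVec, Matrix.smul_mulVec,
    Matrix.vecMulVec_mulVec]
  funext c
  simp
  ring

theorem reductionU_one (M : ℕ) (δ k : ℂ) : reductionU M δ k 1 = MvPolynomial.C (δ / k) *
    (aVar M (-2) ⬝ᵥ (dressing M δ k 0 (-1) *ᵥ bVar M 1)) := by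
  have h := dressCoeff_zero_two (dressEntry M δ k) (MvPolynomial.C k⁻¹) (-2)
  norm_num at h
  rw [reductionU, h, dressing_mulVec, dotProduct_add, dotProduct_smul]
  simp only [dressEntry, smul_eq_mul]
  norm_num
  ring

theorem reductionW_one (M : ℕ) (δ k : ℂ) : reductionW M δ k 1 = MvPolynomial.C (δ / k) *
    (aVar M (-1) ⬝ᵥ bVar M 1) := by
  have h := dressCoeff_zero_one (dressEntry M δ k) (MvPolynomial.C k⁻¹) (-1)
  norm_num at h
  rw [reductionW, h]
  simp [dressEntry]

/-- The two factors `I + (δ / k) b a` expand into the four compositions of a step of length three in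
`dressCoeff_zero_three`; the additional `1 / k` is the `κ` of `dressCoeff_one_one`. -/
theorem reductionW_two (M : ℕ) (δ k : ℂ) : reductionW M δ k 2 = MvPolynomial.C (δ / k ^ 2) *
    (aVar M (-2) ⬝ᵥ ((dressing M δ k 0 (-1) * dressing M δ k 1 0) *ᵥ bVar M 2)) := by
  have h := dressCoeff_zero_three (dressEntry M δ k) (MvPolynomial.C k⁻¹) (-2)
  have h1 := dressCoeff_one_one (dressEntry M δ k) (MvPolynomial.C k⁻¹) (-1)
  norm_num at h h1
  have hc : (MvPolynomial.C (δ / k ^ 2) : LocalPoly M) =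
      MvPolynomial.C k⁻¹ * MvPolynomial.C (δ / k) := by
    rw [← map_mul]
    congr 1
    -- For `k = 0` both sides vanish, by the convention for division by zero.
    by_cases hk : k = 0
    · simp [hk]
    · field_simp
  rw [reductionW, h1, h, ← Matrix.mulVec_mulVec, dressing_mulVec M δ k 1, Matrix.mulVec_add,
    Matrix.mulVec_smul, dressing_mulVec, dressing_mulVec, hc]
  simp only [dressEntry, smul_eq_mul, dotProduct_add, dotProduct_smul]
  norm_num
  ring

/-- The reduced Lax operator of a lattice state. -/
noncomputable def LatticeState.lax {M : ℕ} (s : LatticeState M) (δ k : ℂ) (hk : k ≠ 0) :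
    ReducedLax ℂ⟦X⟧ alpha (PowerSeries.C δ) (PowerSeries.C k) :=
  reducedLax δ k hk fun n m => s.a n ⬝ᵥ s.b m

/-! ### Evaluation of the local coefficients at a site -/

section Evaluation

variable {M : ℕ} (s : LatticeState M) (n : ℤ)

theorem evalAt_C (c : ℂ) : evalAt (MvPolynomial.C c) s n = PowerSeries.C c := by
  rw [evalAt, MvPolynomial.aeval_C]
  rfl

theorem evalAt_dotProduct (i j : ℤ) :
    evalAt (aVar M i ⬝ᵥ bVar M j) s n = s.a (n + i) ⬝ᵥ s.b (n + j) := by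
  simp [evalAt, dotProduct, aVar, bVar]

theorem evalAt_mul (f g : LocalPoly M) : evalAt (f * g) s n = evalAt f s n * evalAt g s n :=
  map_mul _ f g

theorem evalAt_add (f g : LocalPoly M) : evalAt (f + g) s n = evalAt f s n + evalAt g s n :=
  map_add _ f g

/-- Evaluation at the site `n` is a ring homomorphism that translates indices by `n`, so one family
of local polynomials serves every site. -/
theorem evalAt_dressCoeff (δ k : ℂ) (j : ℕ) (x y : ℤ) :
    evalAt (dressCoeff (dressEntry M δ k) (MvPolynomial.C k⁻¹) j x y) s n =
      dressCoeff (fun n m => PowerSeries.C (δ / k) * (s.a n ⬝ᵥ s.b (m + 1)))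
        (PowerSeries.C k⁻¹) j (x + n) (y + n) := by
  rw [← evalAt_C s n k⁻¹]
  refine map_dressCoeff (dressEntry M δ k) _ (MvPolynomial.aeval
    (Sum.elim (fun p => s.a (n + p.1) p.2) (fun p => s.b (n + p.1) p.2))).toRingHom n
    (fun n m => PowerSeries.C (δ / k) * (s.a n ⬝ᵥ s.b (m + 1))) (fun x y => ?_) j x y
  change evalAt (dressEntry M δ k x y) s n = _
  rw [dressEntry, evalAt_mul, evalAt_C, evalAt_dotProduct, add_comm n, add_comm n,
    add_right_comm y]

theorem evalSeries_dressCoeff (δ k : ℂ) (hk : k ≠ 0) (x y : ℤ) :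
    evalSeries (fun j => dressCoeff (dressEntry M δ k) (MvPolynomial.C k⁻¹) j x y) s n =
      (s.lax δ k hk).H (x + n) (y + n) := by
  change alphaSum (fun j => evalAt _ s n) = alphaSum fun j => dressCoeff
    (fun n m => PowerSeries.C (δ / k) * (s.a n ⬝ᵥ s.b (m + 1))) (PowerSeries.C k⁻¹) j (x + n) (y + n)
  rw [funext fun j => evalAt_dressCoeff s n δ k j x y]

theorem evalSeries_eq (f : ℕ → LocalPoly M) :
    evalSeries f s n = evalAt (f 0) s n + alpha * evalSeries (fun j => f (j + 1)) s n :=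
  alphaSum_eq fun j => evalAt (f j) s n

theorem evalSeries_reductionU (δ k : ℂ) (hk : k ≠ 0) :
    evalSeries (reductionU M δ k) s n = (s.lax δ k hk).P n := by
  rw [evalSeries_eq]
  simp only [reductionU]
  rw [evalSeries_dressCoeff s n δ k hk, evalAt_add, evalAt_mul, evalAt_C, evalAt_C,
    evalAt_dotProduct, ReducedLax.P, zero_add, add_zero, neg_add_eq_sub, ← sub_eq_add_neg]
  rfl

theorem evalSeries_reductionW (δ k : ℂ) (hk : k ≠ 0) :
    evalSeries (reductionW M δ k) s n = (s.lax δ k hk).w n := by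
  rw [evalSeries_eq]
  simp only [reductionW]
  rw [evalSeries_dressCoeff s n δ k hk, ReducedLax.w, zero_add, neg_add_eq_sub]
  simp [evalAt]

end Evaluation

/-! ### Time evolution of the dressing matrix -/

section Dynamics

variable {M : ℕ} {s : ℝ → LatticeState M} {t₀ : ℝ} {a' b' : ℤ → Fin M → ℂ⟦X⟧}

theorem exists_hasTimeDerivAt_evalAt
    (ha : ∀ n c, HasTimeDerivAt (fun t => (s t).a n c) (a' n c) t₀)
    (hb : ∀ n c, HasTimeDerivAt (fun t => (s t).b n c) (b' n c) t₀)
    (f : LocalPoly M) (n : ℤ) : ∃ f', HasTimeDerivAt (fun t => evalAt f (s t) n) f' t₀ := by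
  induction f using MvPolynomial.induction_on with
  | C c => exact ⟨0, by simpa only [evalAt_C] using HasTimeDerivAt.const (PowerSeries.C c) t₀⟩
  | add f g hf hg =>
    obtain ⟨f', hf⟩ := hf
    obtain ⟨g', hg⟩ := hg
    exact ⟨_, by simpa only [evalAt_add] using hf.add hg⟩
  | mul_X f i hf =>
    obtain ⟨f', hf⟩ := hf
    simp only [evalAt_mul]
    obtain ⟨i, c⟩ | ⟨i, c⟩ := i
    · exact ⟨_, hf.mul (by simpa [evalAt] using ha (n + i) c)⟩
    · exact ⟨_, hf.mul (by simpa [evalAt] using hb (n + i) c)⟩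

theorem exists_hasTimeDerivAt_evalSeries
    (ha : ∀ n c, HasTimeDerivAt (fun t => (s t).a n c) (a' n c) t₀)
    (hb : ∀ n c, HasTimeDerivAt (fun t => (s t).b n c) (b' n c) t₀)
    (f : ℕ → LocalPoly M) (n : ℤ) :
    ∃ f', HasTimeDerivAt (fun t => evalSeries f (s t) n) f' t₀ := by
  refine exists_hasTimeDerivAt fun m => ?_
  simp only [evalSeries, PowerSeries.coeff_mk]
  refine DifferentiableAt.fun_sum fun j _ => ?_
  obtain ⟨f', hf⟩ := exists_hasTimeDerivAt_evalAt ha hb (f j) n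
  exact (hf _).differentiableAt

theorem hasTimeDerivAt_dotProduct
    (ha : ∀ n c, HasTimeDerivAt (fun t => (s t).a n c) (a' n c) t₀)
    (hb : ∀ n c, HasTimeDerivAt (fun t => (s t).b n c) (b' n c) t₀) (n m : ℤ) :
    HasTimeDerivAt (fun t => (s t).a n ⬝ᵥ (s t).b m)
      (a' n ⬝ᵥ (s t₀).b m + (s t₀).a n ⬝ᵥ b' m) t₀ := by
  simp only [dotProduct, ← Finset.sum_add_distrib]
  exact HasTimeDerivAt.sum _ fun c _ => (ha n c).mul (hb m c)

/-- If the products `aₙ bₘ` move with velocity `dA`, then `H` moves with velocity `dH`. -/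
theorem hasTimeDerivAt_H {δ k : ℂ} (hk : k ≠ 0) (p q : ℂ⟦X⟧)
    (ha : ∀ n c, HasTimeDerivAt (fun t => (s t).a n c) (a' n c) t₀)
    (hb : ∀ n c, HasTimeDerivAt (fun t => (s t).b n c) (b' n c) t₀)
    (hA : ∀ n m, a' n ⬝ᵥ (s t₀).b m + (s t₀).a n ⬝ᵥ b' m =
      ((s t₀).lax δ k hk).dA p q n m) (n m : ℤ) :
    HasTimeDerivAt (fun t => ((s t).lax δ k hk).H n m)
      (((s t₀).lax δ k hk).dH p q n m) t₀ := by
  have hex : ∀ n m, ∃ h', HasTimeDerivAt (fun t => ((s t).lax δ k hk).H n m) h' t₀ := by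
    intro n m
    have h := exists_hasTimeDerivAt_evalSeries ha hb
      (fun j => dressCoeff (dressEntry M δ k) (MvPolynomial.C k⁻¹) j n m) 0
    simpa only [evalSeries_dressCoeff _ _ δ k hk, add_zero] using h
  choose H' hH' using hex
  have hdA : ∀ n m, HasTimeDerivAt (fun t => ((s t).lax δ k hk).A n m)
      (((s t₀).lax δ k hk).dA p q n m) t₀ := fun n m =>
    (hasTimeDerivAt_dotProduct ha hb n m).congr_deriv (hA n m)
  have hκ : PowerSeries.C k⁻¹ * PowerSeries.C k = (1 : ℂ⟦X⟧) := by
    rw [← map_mul, inv_mul_cancel₀ hk, map_one]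
  have hcδ : PowerSeries.C k⁻¹ * PowerSeries.C δ = (PowerSeries.C (δ / k) : ℂ⟦X⟧) := by
    rw [← map_mul, div_eq_inv_mul]
  -- The velocity of `G` is read off from the time derivative of `G_upper`, with the still unknown
  -- `H'`.
  set G' : ℤ → ℤ → ℂ⟦X⟧ := fun n m => if n < m then
    -(PowerSeries.C k⁻¹ * (PowerSeries.C δ * ((s t₀).lax δ k hk).dA p q n (m + 1) +
      alpha * H' (n - 1) (m + 1))) else 0 with hG'def
  have hG' : ∀ n m, HasTimeDerivAt (fun t => ((s t).lax δ k hk).G n m) (G' n m) t₀ := by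
    intro n m
    obtain h | rfl | h := lt_trichotomy n m
    · simp only [hG'def, if_pos h]
      have h1 : ∀ t, ((s t).lax δ k hk).G n m = -(PowerSeries.C k⁻¹ *
          (PowerSeries.C δ * ((s t).lax δ k hk).A n (m + 1) +
            alpha * ((s t).lax δ k hk).H (n - 1) (m + 1))) := fun t => by
        linear_combination PowerSeries.C k⁻¹ * ((s t).lax δ k hk).G_upper n m h
          - ((s t).lax δ k hk).G n m * hκ
      simp only [h1]
      exact ((((hdA _ _).const_mul _).add ((hH' _ _).const_mul _)).const_mul _).neg
    · simp only [ReducedLax.G_diag, hG'def, lt_irrefl, if_false]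
      exact HasTimeDerivAt.const 1 t₀
    · simp only [ReducedLax.G_lower _ n m h, hG'def, if_neg h.not_gt]
      exact HasTimeDerivAt.const 0 t₀
  refine (hH' n m).congr_deriv (((s t₀).lax δ k hk).velocity_unique p q hκ (fun x hx =>
    eq_of_X_pow_dvd fun N => by simpa using hx N) (G' := G') (fun n m h => if_neg h.not_gt)
    (fun n m h => ?_) (fun n m h => ?_) (fun n m => ?_) n m)
  · have h1 := hH' n m
    simp only [ReducedLax.H_lower _ n m h] at h1
    exact h1.unique (HasTimeDerivAt.const 0 t₀)
  · simp only [hG'def, if_pos h]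
    linear_combination (-(PowerSeries.C δ * ((s t₀).lax δ k hk).dA p q n (m + 1) +
      alpha * H' (n - 1) (m + 1))) * hκ
  · have h1 := HasTimeDerivAt.sum (Finset.Icc (n - 2) (m + 2)) fun x _ =>
      (hG' n x).mul (hH' x m)
    simp only [ReducedLax.G_mul_H _ n m (n - 2) (m + 2) (by omega) (by omega)] at h1
    exact h1.unique (HasTimeDerivAt.const _ t₀)

end Dynamics

/-! ### The reduction for all the flows -/

theorem admitsReduction_linComb (M : ℕ) {δ k β : ℂ} (hδ : δ ≠ 0) (hk : k ≠ 0) (hβ : β ≠ 0)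
    (μ ν : ℂ⟦X⟧) : AdmitsReduction β δ (reductionU M δ k) (reductionW M δ k)
      (linComb μ ν (firstFlow β δ) (secondFlow β δ)) := by
  intro s t₀ hc hU hW ha hb n
  simp only [evalSeries_reductionU _ _ δ k hk] at hU
  simp only [evalSeries_reductionW _ _ δ k hk] at hW
  set D := (s t₀).lax δ k hk with hD
  have hU₀ : ∀ n, PowerSeries.C β * (s t₀).uPow δ n = D.P n := fun n => (hU n).self_of_nhds
  have hW₀ : ∀ n, (s t₀).w n = D.w n := fun n => (hW n).self_of_nhds
  have hβδ : (PowerSeries.C (β * δ) : ℂ⟦X⟧) = PowerSeries.C δ * PowerSeries.C β := by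
    rw [← map_mul, mul_comm]
  have hAD : ∀ n m, (s t₀).a n ⬝ᵥ (s t₀).b m = D.A n m := fun _ _ => rfl
  -- The second flow acts on `a`, `b` as `δ` times the `P S` part of the first, hence it changes `p`
  -- but not `q = μ`.
  set p := μ + PowerSeries.C δ * ν with hp
  have hA : ∀ n m, (linComb μ ν (firstFlow β δ) (secondFlow β δ) (s t₀)).a n ⬝ᵥ (s t₀).b m +
      (s t₀).a n ⬝ᵥ (linComb μ ν (firstFlow β δ) (secondFlow β δ) (s t₀)).b m =
      D.dA p μ n m := by
    intro n m
    simp only [linComb, firstFlow, secondFlow, hβδ, mul_assoc, hU₀, hW₀, add_dotProduct,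
      dotProduct_add, smul_dotProduct, dotProduct_smul, dotProduct_neg, hAD,
      smul_eq_mul, ReducedLax.dA]
    ring
  have hH := hasTimeDerivAt_H hk p μ ha hb hA
  constructor
  · have hP : HasTimeDerivAt (fun t => ((s t).lax δ k hk).P n)
        (D.P n * ((p - μ) * (D.w n - D.w (n - 1)) +
          PowerSeries.C δ * (p * (D.A n n - D.A (n - 1) (n - 1))))) t₀ := by
      refine ((((HasTimeDerivAt.const (PowerSeries.C k) t₀).add
        (((hasTimeDerivAt_dotProduct ha hb (n - 1) n).congr_deriv (hA _ _)).const_mul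
          (PowerSeries.C δ))).add ((hH (n - 2) n).const_mul alpha))).congr_deriv ?_
      rw [zero_add, D.dP]
    have hβ' : PowerSeries.C β⁻¹ * PowerSeries.C β = (1 : ℂ⟦X⟧) := by
      rw [← map_mul, inv_mul_cancel₀ hβ, map_one]
    have hu := ((hP.congr (hU n)).const_mul (PowerSeries.C β⁻¹))
    simp only [← mul_assoc, hβ', one_mul] at hu
    -- As `p - μ = δ ν`, the logarithmic velocity of `P` is `δ` times this `g`.
    refine (hasTimeDerivAt_formalExp_of_pow hδ (hc n)
      (g := ν * (D.w n - D.w (n - 1)) + p * (D.A n n - D.A (n - 1) (n - 1)))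
      (hu.congr_deriv ?_)).congr_deriv ?_
    · change _ = (s t₀).uPow δ n * _
      rw [← hU₀]
      linear_combination ((s t₀).uPow δ n * ((p - μ) * (D.w n - D.w (n - 1)) +
          PowerSeries.C δ * (p * (D.A n n - D.A (n - 1) (n - 1))))) * hβ' +
          (s t₀).uPow δ n * (D.w n - D.w (n - 1)) * hp
    · change (s t₀).u n * _ = _
      simp only [linComb, firstFlow, secondFlow, hW₀, hAD]
      linear_combination (s t₀).u n * (D.A n n - D.A (n - 1) (n - 1)) * hp
  · refine (((hH (n - 1) n).const_mul alpha).congr (hW n)).congr_deriv ?_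
    rw [D.alpha_mul_dH_w]
    simp only [linComb, firstFlow, secondFlow, hβδ, hAD]
    rw [← hU₀, ← hU₀]
    linear_combination (alpha * PowerSeries.C β * ((s t₀).uPow δ (n + 1) - (s t₀).uPow δ n)) * hp

theorem eq_linComb_one_zero {M : ℕ} (F G : Flow M) : F = linComb 1 0 F G := by
  funext s
  simp [linComb]

theorem eq_linComb_zero_one {M : ℕ} (F G : Flow M) : G = linComb 0 1 F G := by
  funext s
  simp [linComb]

end GenToda

theorem mainTheorem1 (M : ℕ) (δ k : ℂ) (hδ : δ ≠ 0) (hk : k ≠ 0) :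
    ∃ U W : ℕ → GenToda.LocalPoly M,
      U 0 = MvPolynomial.C k
        + MvPolynomial.C δ * (GenToda.aVar M (-1) ⬝ᵥ GenToda.bVar M 0) ∧
      U 1 = MvPolynomial.C (δ / k) *
        (GenToda.aVar M (-2) ⬝ᵥ (GenToda.dressing M δ k 0 (-1) *ᵥ GenToda.bVar M 1)) ∧
      W 0 = 0 ∧
      W 1 = MvPolynomial.C (δ / k) * (GenToda.aVar M (-1) ⬝ᵥ GenToda.bVar M 1) ∧
      W 2 = MvPolynomial.C (δ / k ^ 2) *
        (GenToda.aVar M (-2) ⬝ᵥ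
          ((GenToda.dressing M δ k 0 (-1) * GenToda.dressing M δ k 1 0) *ᵥ
            GenToda.bVar M 2)) ∧
      ∀ β : ℂ, β ≠ 0 →
        GenToda.AdmitsReduction β δ U W (GenToda.firstFlow β δ) ∧
        GenToda.AdmitsReduction β δ U W (GenToda.secondFlow β δ) ∧
        ∀ μ ν : ℂ⟦X⟧, GenToda.AdmitsReduction β δ U W
          (GenToda.linComb μ ν (GenToda.firstFlow β δ) (GenToda.secondFlow β δ)) := by
  refine ⟨GenToda.reductionU M δ k, GenToda.reductionW M δ k, rfl, GenToda.reductionU_one M δ k,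
    rfl, GenToda.reductionW_one M δ k, GenToda.reductionW_two M δ k, fun β hβ => ⟨?_, ?_,
      GenToda.admitsReduction_linComb M hδ hk hβ⟩⟩
  · rw [GenToda.eq_linComb_one_zero (GenToda.firstFlow β δ) (GenToda.secondFlow β δ)]
    exact GenToda.admitsReduction_linComb M hδ hk hβ 1 0
  · rw [GenToda.eq_linComb_zero_one (GenToda.firstFlow β δ) (GenToda.secondFlow β δ)]
    exact GenToda.admitsReduction_linComb M hδ hk hβ 0 1
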